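/- Let $\mathbb{Z}^2$ denote the square lattice graph: its vertices are the points of $\mathbb{Z}\times\mathbb{Z}$, and two vertices are adjacent if and only if their $\ell^1$-distance is $1$. A bond percolation model on a graph $G$ is a probability distribution on the spanning subgraphs of $G$ (equivalently, on $\{\text{open},\text{closed}\}^{E(G)}$ with the product $\sigma$-algebra). It is 1-independent if, for any two sets of edges $S_1,S_2\subseteq E(G)$ such that no edge of $S_1$ shares a vertex with an edge of $S_2$, the states of the edges in $S_1$ are independent of the states of the edges in $S_2$. For an infinite graph $G$, the model percolates if, with positive probability, the random subgraph formed by the open edges has an infinite connected component. For real $p$, let $\mathcal{D}_{\ge p}(G)$ be the class of 1-independent bond percolation models on $G$ in which each edge is open with probability at least $p$, and define \[ p_{\max}(G)=\sup\{p : \text{some model in } \mathcal{D}_{\ge p}(G) \text{ does not percolate}\}. \] **Theorem.** Every model in $\mathcal{D}_{\ge 0.8457}(\mathbb{Z}^2)$ percolates. Consequently \[ p_{\max}(\mathbb{Z}^2)\le 0.8457. \] -/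

import Mathlib

open MeasureTheory ProbabilityTheory

namespace Percolation

/-- The square lattice on `ℤ × ℤ`: two sites are adjacent iff their `ℓ¹`-distance is `1`. -/
def squareLattice : SimpleGraph (ℤ × ℤ) where
  Adj u v := |u.1 - v.1| + |u.2 - v.2| = 1
  symm := ⟨fun u v h => by rwa [abs_sub_comm v.1, abs_sub_comm v.2]⟩
  loopless := ⟨fun u h => by simp at h⟩

variable {V : Type*}

/-- A bond configuration on `G`, i.e. a spanning subgraph of `G`: `true` means open, `false`
means closed. It carries the product σ-algebra. -/
abbrev BondConfig (G : SimpleGraph V) : Type _ := G.edgeSet → Bool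

/-- The spanning subgraph of `G` whose edges are the open edges of `ω`. -/
def openSubgraph {G : SimpleGraph V} (ω : BondConfig G) : SimpleGraph V where
  Adj u v := ∃ h : s(u, v) ∈ G.edgeSet, ω ⟨s(u, v), h⟩ = true
  symm := ⟨fun u v h => by rwa [Sym2.eq_swap]⟩
  loopless := ⟨fun u h => by
    obtain ⟨h, -⟩ := h
    exact G.irrefl (G.mem_edgeSet.mp h)⟩

/-- A bond percolation model on `G`: a probability distribution on bond configurations. -/
abbrev BondModel (G : SimpleGraph V) : Type _ := ProbabilityMeasure (BondConfig G)

/-- 1-independence: the states of the edges in `S₁` are independent of the states of the edges in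
`S₂` whenever no edge of `S₁` shares a vertex with an edge of `S₂` (so that `S₁` and `S₂` are in
particular disjoint). The sets may be infinite. -/
def IsOneIndependent {G : SimpleGraph V} (μ : BondModel G) : Prop :=
  ∀ S₁ S₂ : Set G.edgeSet,
    (∀ e ∈ S₁, ∀ f ∈ S₂, ∀ v : V, v ∈ (e : Sym2 V) → v ∉ (f : Sym2 V)) →
      IndepFun (fun (ω : BondConfig G) (e : S₁) => ω e) (fun (ω : BondConfig G) (f : S₂) => ω f)
        (μ : Measure (BondConfig G))

/-- The class `𝒟_{≥ p}(G)` of 1-independent bond percolation models on `G` in which each edge is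
open with probability at least `p`. -/
def oneIndependentModels (G : SimpleGraph V) (p : ℝ) : Set (BondModel G) :=
  {μ | IsOneIndependent μ ∧
    ∀ e : G.edgeSet, p ≤ (μ : Measure (BondConfig G)).real {ω | ω e = true}}

/-- The model percolates: with positive probability, the open subgraph has an infinite
connected component. -/
def Percolates {G : SimpleGraph V} (μ : BondModel G) : Prop :=
  0 < (μ : Measure (BondConfig G))
    {ω | ∃ C : (openSubgraph ω).ConnectedComponent, C.supp.Infinite}

/-- `p_max(G)`, the supremum of the `p` for which some model in `𝒟_{≥ p}(G)` does not percolate. -/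
noncomputable def pMax (G : SimpleGraph V) : ℝ :=
  sSup {p : ℝ | ∃ μ ∈ oneIndependentModels G p, ¬ Percolates μ}

end Percolation

/-! This is a Peierls argument adapted to 1-independence. If all open clusters are finite, the
clusters meeting a long segment of the right half axis form a finite set whose boundary edges are
all closed. By planar duality mod 2 (`exists_boundary_chain`) these edges, linked through common
faces, join the right half axis to the left one. Consecutive edges of such a chain touch, so they
need not be independent. Last-exit extraction (`exists_escaping_of_isChain`) thins the chain to
pairwise non-touching edges, each on the rim of its predecessor. A sequence of `n` such edges is
closed with probability at most `(1 - p) ^ n` (`real_allClosed_le`). A rim has ten edges, too many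
for a step-by-step union bound. Avoiding earlier neighbourhoods leaves at most 261 continuations per
three steps, and `261 * (1 - 0.8457) ^ 3 < 1`. Borel–Cantelli over the starting point then gives an
infinite cluster almost surely. -/

namespace Percolation

/-- Coordinates for the edges of the square lattice: `(x, y, false)` is the horizontal edge from
`(x, y)` to `(x + 1, y)`, and `(x, y, true)` is the vertical edge from `(x, y)` to `(x, y + 1)`. -/
abbrev GridEdge : Type := ℤ × ℤ × Bool

/-! ### Local geometry of lattice edges -/

namespace GridEdge

/-- The left or lower end of an edge. -/
def src (e : GridEdge) : ℤ × ℤ := (e.1, e.2.1)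

/-- The right or upper end of an edge. -/
def tgt (e : GridEdge) : ℤ × ℤ := bif e.2.2 then (e.1, e.2.1 + 1) else (e.1 + 1, e.2.1)

/-- The offsets `(dx, dy, t)` of the edges that share a vertex with an edge of direction `s` based
at the origin. -/
def touchAt : Bool → GridEdge → Bool
  | false, (x, y, false) => decide (-1 ≤ x) && decide (x ≤ 1) && decide (y = 0)
  | true, (x, y, true) => decide (x = 0) && decide (-1 ≤ y) && decide (y ≤ 1)
  | false, (x, y, true) => decide (0 ≤ x) && decide (x ≤ 1) && decide (-1 ≤ y) && decide (y ≤ 0)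
  | true, (x, y, false) => decide (-1 ≤ x) && decide (x ≤ 0) && decide (0 ≤ y) && decide (y ≤ 1)

/-- The offsets of the edges that bound one of the six unit faces incident with an edge of
direction `s` based at the origin. -/
def nearAt : Bool → GridEdge → Bool
  | false, (x, y, false) => decide (-1 ≤ x) && decide (x ≤ 1) && decide (-1 ≤ y) && decide (y ≤ 1)
  | true, (x, y, true) => decide (-1 ≤ x) && decide (x ≤ 1) && decide (-1 ≤ y) && decide (y ≤ 1)
  | false, (x, y, true) => decide (-1 ≤ x) && decide (x ≤ 2) && decide (-1 ≤ y) && decide (y ≤ 0)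
  | true, (x, y, false) => decide (-1 ≤ x) && decide (x ≤ 0) && decide (-1 ≤ y) && decide (y ≤ 2)

/-- The offset of `f` relative to the base point of `e`. -/
def offset (e f : GridEdge) : GridEdge := (f.1 - e.1, f.2.1 - e.2.1, f.2.2)

/-- `e` and `f` share a vertex. -/
def Touch (e f : GridEdge) : Prop := touchAt e.2.2 (offset e f) = true

/-- `f` bounds a unit face that is incident with a vertex of `e`. -/
def Near (e f : GridEdge) : Prop := nearAt e.2.2 (offset e f) = true

/-- `f` lies on the boundary of the union of the six unit faces incident with `e`. -/
def Rim (e f : GridEdge) : Prop := Near e f ∧ ¬ Touch e f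

/-- The edges of the unit face with lower left corner `(a, b)`. -/
def OnFace (a b : ℤ) (e : GridEdge) : Prop :=
  e = (a, b, false) ∨ e = (a, b + 1, false) ∨ e = (a, b, true) ∨ e = (a + 1, b, true)

/-- `e` and `f` bound a common unit face. -/
def Link (e f : GridEdge) : Prop := ∃ a b, OnFace a b e ∧ OnFace a b f

theorem touch_of_common_vertex {e f : GridEdge} {v : ℤ × ℤ} (he : v = e.src ∨ v = e.tgt)
    (hf : v = f.src ∨ v = f.tgt) : Touch e f := by
  obtain ⟨x, y, s⟩ := e
  obtain ⟨x', y', t⟩ := f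
  obtain ⟨a, b⟩ := v
  cases s <;> cases t <;> simp [src, tgt, Touch, touchAt, offset] at * <;> omega

theorem Touch.near {e f : GridEdge} (h : Touch e f) : Near e f := by
  obtain ⟨x, y, s⟩ := e
  obtain ⟨x', y', t⟩ := f
  cases s <;> cases t <;> simp [Touch, touchAt, Near, nearAt, offset] at * <;> omega

theorem touch_self (e : GridEdge) : Touch e e := by
  obtain ⟨x, y, s⟩ := e
  cases s <;> simp [Touch, touchAt, offset]

/-- A face bounded by `f` contains both ends of `f`, one of which is an end of `e`. Hence a walk
cannot leave the neighbourhood of `e` directly from an edge touching `e`. -/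
theorem near_of_touch_of_link {e f g : GridEdge} (h : Touch e f) (h' : Link f g) : Near e g := by
  obtain ⟨x, y, s⟩ := e
  obtain ⟨a, b, h₁, h₂⟩ := h'
  rcases h₁ with rfl | rfl | rfl | rfl <;> rcases h₂ with rfl | rfl | rfl | rfl <;> cases s <;>
    simp [Touch, touchAt, Near, nearAt, offset] at * <;> omega

theorem Near.sub_two_le {e f : GridEdge} (h : Near e f) : e.1 - 2 ≤ f.1 := by
  obtain ⟨x, y, s⟩ := e
  obtain ⟨x', y', t⟩ := f
  cases s <;> cases t <;> simp [Near, nearAt, offset] at * <;> omega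

/-! ### Counting escaping sequences -/

/-- The ten offsets of the rim of an edge of direction `s`. -/
def rimList : Bool → List GridEdge
  | false => [(0, 1, false), (0, -1, false), (1, 1, false), (1, -1, false), (-1, 1, false),
      (-1, -1, false), (2, 0, true), (2, -1, true), (-1, 0, true), (-1, -1, true)]
  | true => [(1, 0, true), (-1, 0, true), (1, 1, true), (-1, 1, true), (1, -1, true),
      (-1, -1, true), (0, 2, false), (-1, 2, false), (0, -1, false), (-1, -1, false)]

/-- The edge whose offset relative to `e` is `d`. -/
def translate (e d : GridEdge) : GridEdge := (e.1 + d.1, e.2.1 + d.2.1, d.2.2)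

theorem translate_offset (e f : GridEdge) : translate e (offset e f) = f := by
  simp [translate, offset]

theorem Rim.offset_mem {e f : GridEdge} (h : Rim e f) : offset e f ∈ rimList e.2.2 := by
  obtain ⟨x, y, s⟩ := e
  obtain ⟨x', y', t⟩ := f
  obtain ⟨h₁, h₂⟩ := h
  cases s <;> cases t <;> simp [Near, nearAt, Touch, touchAt, offset, rimList] at * <;> omega

theorem offset_offset (a e f : GridEdge) : offset (offset a e) (offset a f) = offset e f := by
  simp [offset]

theorem near_offset {a e f : GridEdge} : Near (offset a e) (offset a f) ↔ Near e f := by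
  simp only [Near, offset_offset]
  rfl

theorem rim_offset {a e f : GridEdge} : Rim (offset a e) (offset a f) ↔ Rim e f := by
  simp only [Rim, Near, Touch, offset_offset]
  rfl

/-- The rim of an edge, as a list. -/
def rim (e : GridEdge) : List GridEdge := (rimList e.2.2).map (translate e)

theorem Rim.mem_rim {e f : GridEdge} (h : Rim e f) : f ∈ rim e :=
  List.mem_map.2 ⟨_, h.offset_mem, translate_offset e f⟩

/-- The elements of `rim e` outside the neighbourhoods of the edges in `l`. -/
def freeRim (e : GridEdge) (l : List GridEdge) : List GridEdge :=
  (rim e).filter fun f => l.all fun g => !nearAt g.2.2 (offset g f)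

theorem mem_freeRim {e f : GridEdge} {l : List GridEdge} (h : Rim e f) (hl : ∀ g ∈ l, ¬ Near g f) :
    f ∈ freeRim e l := by
  refine List.mem_filter.2 ⟨h.mem_rim, ?_⟩
  simpa [Near] using hl

/-- The three-step continuations of the pair `a, b`. -/
def extensions (a b : GridEdge) : List (GridEdge × GridEdge × GridEdge) :=
  (freeRim b [a]).flatMap fun c => (freeRim c [a, b]).flatMap fun d =>
    (freeRim d [a, b, c]).map fun f => (c, d, f)

/-- By translation invariance, the two directions of `a` and the ten rim offsets of `b` cover every
case, so a finite computation suffices. -/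
theorem length_extensions_le_of_base :
    ∀ s ∈ [false, true], ∀ b ∈ rimList s, (extensions (0, 0, s) b).length ≤ 261 := by
  decide +kernel

/-- A sequence of edges each of which lies on the rim of its predecessor and outside the
neighbourhoods of all earlier edges. -/
def Escaping : List GridEdge → Prop
  | [] => True
  | [_] => True
  | a :: b :: t => Rim a b ∧ (∀ g ∈ t, ¬ Near a g) ∧ Escaping (b :: t)

theorem Escaping.tail {a : GridEdge} {l : List GridEdge} (h : Escaping (a :: l)) : Escaping l := by
  cases l with
  | nil => trivial
  | cons b t => exact h.2.2

theorem Escaping.take {l : List GridEdge} (h : Escaping l) (n : ℕ) : Escaping (l.take n) := by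
  induction l generalizing n with
  | nil => simp [Escaping]
  | cons a l ih =>
    cases n with
    | zero => simp [Escaping]
    | succ n =>
      cases l with
      | nil => simp [Escaping]
      | cons b t =>
        cases n with
        | zero => simp [Escaping]
        | succ n =>
          have := ih h.tail (n + 1)
          exact ⟨h.1, fun g hg => h.2.1 g (List.mem_of_mem_take hg), this⟩

theorem Escaping.pairwise_not_touch {l : List GridEdge} (h : Escaping l) :
    l.Pairwise fun e f => ¬ Touch e f := by
  induction l with
  | nil => simp
  | cons a l ih =>
    refine List.Pairwise.cons ?_ (ih h.tail)
    cases l with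
    | nil => simp
    | cons b t =>
      intro g hg
      rcases List.mem_cons.1 hg with rfl | hg
      · exact h.1.2
      · exact fun hT => h.2.1 g hg hT.near

/-- The three-step continuations of the pair `a, b`, computed relative to the base point of `a`. -/
def extensionsFrom (a b : GridEdge) : List (GridEdge × GridEdge × GridEdge) :=
  if offset a b ∈ rimList a.2.2 then
    (extensions (0, 0, a.2.2) (offset a b)).map
      fun p => (translate a p.1, translate a p.2.1, translate a p.2.2)
  else []

theorem length_extensionsFrom_le (a b : GridEdge) : (extensionsFrom a b).length ≤ 261 := by
  unfold extensionsFrom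
  split_ifs with h
  · rw [List.length_map]
    exact length_extensions_le_of_base _ (by cases a.2.2 <;> simp) _ h
  · simp

theorem mem_extensionsFrom {a b c d f : GridEdge} {t : List GridEdge}
    (h : Escaping (a :: b :: c :: d :: f :: t)) : (c, d, f) ∈ extensionsFrom a b := by
  obtain ⟨h₁, h₂, h₃, h₄, h₅, h₆, h₇, -⟩ := h
  have ha : ((0, 0, a.2.2) : GridEdge) = offset a a := by simp [offset]
  have hc : offset a c ∈ freeRim (offset a b) [offset a a] := by
    refine mem_freeRim (rim_offset.2 h₃) ?_
    simpa [near_offset] using h₂ c (by simp)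
  have hd : offset a d ∈ freeRim (offset a c) [offset a a, offset a b] := by
    refine mem_freeRim (rim_offset.2 h₅) ?_
    simpa [near_offset] using ⟨h₂ d (by simp), h₄ d (by simp)⟩
  have hf : offset a f ∈ freeRim (offset a d) [offset a a, offset a b, offset a c] := by
    refine mem_freeRim (rim_offset.2 h₇) ?_
    simpa [near_offset] using ⟨h₂ f (by simp), h₄ f (by simp), h₆ f (by simp)⟩
  unfold extensionsFrom
  rw [if_pos h₁.offset_mem, ha]
  refine List.mem_map.2 ⟨(offset a c, offset a d, offset a f), ?_, by simp [translate_offset]⟩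
  simp only [extensions, List.mem_flatMap, List.mem_map]
  exact ⟨_, hc, _, hd, _, hf, rfl⟩

/-- A finite set of sequences of length `3 * m` that contains all escaping continuations of the
pair `a, b` of this length. -/
def continuations : ℕ → GridEdge → GridEdge → Finset (List GridEdge)
  | 0, _, _ => {[]}
  | m + 1, a, b => (extensionsFrom a b).toFinset.biUnion fun p =>
      (continuations m p.2.1 p.2.2).image fun t => p.1 :: p.2.1 :: p.2.2 :: t

theorem card_continuations_le (m : ℕ) (a b : GridEdge) :
    (continuations m a b).card ≤ 261 ^ m := by
  induction m generalizing a b with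
  | zero => simp [continuations]
  | succ m ih =>
    rw [pow_succ']
    refine (Finset.card_biUnion_le_card_mul _ _ _
      fun p _ => Finset.card_image_le.trans (ih _ _)).trans ?_
    exact Nat.mul_le_mul_right _ ((List.toFinset_card_le _).trans (length_extensionsFrom_le a b))

/-- Each block of three restarts from the last two edges of the previous block. Forgetting the
earlier edges only weakens the constraints, so no escaping sequence is lost. -/
theorem mem_continuations {m : ℕ} {a b : GridEdge} {t : List GridEdge}
    (h : Escaping (a :: b :: t)) (hl : t.length = 3 * m) : t ∈ continuations m a b := by
  induction m generalizing a b t with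
  | zero => simpa [continuations] using hl
  | succ m ih =>
    match t, hl with
    | c :: d :: f :: t, hl =>
      refine Finset.mem_biUnion.2 ⟨(c, d, f), List.mem_toFinset.2 (mem_extensionsFrom h), ?_⟩
      refine Finset.mem_image.2 ⟨t, ih h.tail.tail.tail ?_, rfl⟩
      simp only [List.length_cons] at hl
      omega

/-- A finite set of sequences that contains all escaping sequences of length `3 * m + 2` that start
with `e`. -/
def escapingFrom (m : ℕ) (e : GridEdge) : Finset (List GridEdge) :=
  (rim e).toFinset.biUnion fun b => (continuations m e b).image fun t => e :: b :: t

theorem card_escapingFrom_le (m : ℕ) (e : GridEdge) :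
    (escapingFrom m e).card ≤ 10 * 261 ^ m := by
  refine (Finset.card_biUnion_le_card_mul _ _ _
    fun p _ => Finset.card_image_le.trans (card_continuations_le _ _ _)).trans ?_
  refine Nat.mul_le_mul_right _ ((List.toFinset_card_le _).trans ?_)
  rw [rim, List.length_map]
  cases e.2.2 <;> simp [rimList]

theorem mem_escapingFrom {m : ℕ} {e : GridEdge} {l : List GridEdge}
    (h : Escaping (e :: l)) (hl : l.length = 3 * m + 1) : e :: l ∈ escapingFrom m e := by
  match l, hl with
  | b :: t, hl =>
    refine Finset.mem_biUnion.2 ⟨b, List.mem_toFinset.2 h.1.mem_rim, ?_⟩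
    refine Finset.mem_image.2 ⟨t, mem_continuations h ?_, rfl⟩
    simpa using hl

/-! ### From walks to escaping sequences -/

/-- Last-exit extraction: a walk along common faces contains an escaping sequence with the same
start whose last edge is near the end of the walk. -/
theorem exists_escaping_of_isChain (l : List GridEdge) (e : GridEdge)
    (hl : (e :: l).IsChain Link) :
    ∃ t : List GridEdge, t ⊆ l ∧ Escaping (e :: t) ∧
      Near ((e :: t).getLast (by simp)) ((e :: l).getLast (by simp)) := by
  induction hn : l.length using Nat.strong_induction_on generalizing l e with
  | _ n ih =>
    subst hn
    by_cases hlast : Near e ((e :: l).getLast (by simp))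
    · exact ⟨[], by simp, by simp [Escaping], by simpa using hlast⟩
    classical
    -- split the walk at the last edge near `e`
    obtain ⟨l₁, f, l₂, hsplit, hf, hl₂⟩ : ∃ l₁ f l₂, e :: l = l₁ ++ f :: l₂ ∧ Near e f ∧
        ∀ g ∈ l₂, ¬ Near e g := by
      have key : ∀ w : List GridEdge, (∃ g ∈ w, Near e g) →
          ∃ l₁ f l₂, w = l₁ ++ f :: l₂ ∧ Near e f ∧ ∀ g ∈ l₂, ¬ Near e g := by
        intro w
        induction w with
        | nil => simp
        | cons a w ihw =>
          intro hw
          by_cases h : ∃ g ∈ w, Near e g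
          · obtain ⟨l₁, f, l₂, rfl, h₁, h₂⟩ := ihw h
            exact ⟨a :: l₁, f, l₂, rfl, h₁, h₂⟩
          · push Not at h
            obtain ⟨g, hg, hn⟩ := hw
            rcases List.mem_cons.1 hg with rfl | hg
            · exact ⟨[], g, w, rfl, hn, h⟩
            · exact absurd hn (h g hg)
      exact key _ ⟨e, by simp, (touch_self e).near⟩
    have hl₂' : l₂ ≠ [] := by
      rintro rfl
      apply hlast
      simp only [hsplit]
      simpa using hf
    obtain ⟨g, l₃, rfl⟩ := List.exists_cons_of_ne_nil hl₂'
    have hchain : (f :: g :: l₃).IsChain Link := by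
      rw [hsplit] at hl
      exact hl.right_of_append
    have hfg : Link f g := by
      have := hchain
      simp only [List.isChain_cons_cons] at this
      exact this.1
    have hnt : ¬ Touch e f := fun h => hl₂ g (by simp) (near_of_touch_of_link h hfg)
    have hl₁ : l₁ ≠ [] := by
      rintro rfl
      simp only [List.nil_append, List.cons.injEq] at hsplit
      exact hnt (hsplit.1 ▸ touch_self e)
    obtain ⟨a, l₄, rfl⟩ := List.exists_cons_of_ne_nil hl₁
    simp only [List.cons_append, List.cons.injEq] at hsplit
    obtain ⟨rfl, rfl⟩ := hsplit
    -- Recursing on the walk from `f` keeps the later edges inside `g :: l₃`, which avoids the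
    -- neighbourhood of `e`.
    obtain ⟨t, ht, hE, hN⟩ := ih (g :: l₃).length (by simp; omega) (g :: l₃) f hchain rfl
    refine ⟨f :: t, ?_, ⟨⟨hf, hnt⟩, fun x hx => hl₂ x (ht hx), hE⟩, ?_⟩
    · intro x hx
      rcases List.mem_cons.1 hx with rfl | hx
      · simp
      · have := ht hx
        simp only [List.mem_append, List.mem_cons] at this ⊢
        tauto
    · simpa [List.getLast_append] using hN

theorem Escaping.le_getLast {e : GridEdge} {t : List GridEdge} (h : Escaping (e :: t)) :
    e.1 - 2 * t.length ≤ ((e :: t).getLast (by simp)).1 := by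
  induction t generalizing e with
  | nil => simp
  | cons b t ih =>
    have h₁ := h.1.1.sub_two_le
    have h₂ := ih h.tail
    simp only [List.length_cons, List.getLast_cons_cons] at h₂ ⊢
    push_cast
    omega

/-! ### Planar duality mod 2 -/

/-- The edge boundary of a set of vertices. -/
def InBoundary (S : Set (ℤ × ℤ)) (e : GridEdge) : Prop := ¬ (e.src ∈ S ↔ e.tgt ∈ S)

/-- Two boundary edges of `S` on a common face. -/
def BoundaryLink (S : Set (ℤ × ℤ)) (e f : GridEdge) : Prop :=
  InBoundary S e ∧ InBoundary S f ∧ Link e f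

open Classical in
/-- The indicator of a set of vertices with values in `ZMod 2`. -/
noncomputable def parity (S : Set (ℤ × ℤ)) (x y : ℤ) : ZMod 2 := if (x, y) ∈ S then 1 else 0

open Classical in
theorem ite_inBoundary (S : Set (ℤ × ℤ)) (e : GridEdge) :
    (if InBoundary S e then (1 : ZMod 2) else 0) =
      parity S e.src.1 e.src.2 + parity S e.tgt.1 e.tgt.2 := by
  have h2 : (1 : ZMod 2) + 1 = 0 := by decide
  unfold InBoundary parity
  by_cases h₁ : e.src ∈ S <;> by_cases h₂ : e.tgt ∈ S <;> simp [h₁, h₂, h2]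

theorem sum_range_add_succ (u : ℕ → ZMod 2) (n : ℕ) :
    ∑ i ∈ Finset.range n, (u i + u (i + 1)) = u 0 + u n := by
  have h2 : ∀ a : ZMod 2, a + a = 0 := by decide
  induction n with
  | zero => simp [h2]
  | succ n ih =>
    rw [Finset.sum_range_succ, ih]
    linear_combination h2 (u n)

/-- A finite set of vertices that contains the origin has a chain of boundary edges along common
faces that joins the right half of the horizontal axis to its left half. -/
theorem exists_boundary_chain {S : Set (ℤ × ℤ)} (hS : S.Finite) (h0 : ((0, 0) : ℤ × ℤ) ∈ S) :
    ∃ x x' : ℤ, 0 ≤ x ∧ x' < 0 ∧ InBoundary S (x, 0, false) ∧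
      Relation.ReflTransGen (BoundaryLink S) (x, 0, false) (x', 0, false) := by
  classical
  obtain ⟨M, hM⟩ : ∃ M : ℕ, ∀ v ∈ S, |v.1| < M ∧ |v.2| < M := by
    obtain ⟨A, hA⟩ := (hS.image fun v => max |v.1| |v.2|).bddAbove
    refine ⟨A.toNat + 1, fun v hv => ?_⟩
    have := hA ⟨v, hv, rfl⟩
    simp only [sup_le_iff] at this
    push_cast
    have := Int.self_le_toNat A
    omega
  have hout : ∀ x y : ℤ, (M : ℤ) ≤ |x| ∨ (M : ℤ) ≤ |y| → parity S x y = 0 := by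
    intro x y h
    refine if_neg fun hxy => ?_
    have := hM _ hxy
    simp only at this
    omega
  -- the boundary edges joined to the right half axis
  let K : GridEdge → Prop := fun e => InBoundary S e ∧ ∃ x : ℤ, 0 ≤ x ∧
    InBoundary S (x, 0, false) ∧ Relation.ReflTransGen (BoundaryLink S) (x, 0, false) e
  let b : GridEdge → ZMod 2 := fun e => if InBoundary S e then 1 else 0
  let k : GridEdge → ZMod 2 := fun e => if K e then 1 else 0
  have hb : ∀ e, b e = parity S e.src.1 e.src.2 + parity S e.tgt.1 e.tgt.2 := ite_inBoundary S
  have hk0 : ∀ e, b e = 0 → k e = 0 := by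
    intro e h
    refine if_neg fun hK => ?_
    simp [b, hK.1] at h
  have h2 : ∀ a : ZMod 2, a + a = 0 := by decide
  -- A face has an even number of boundary edges, and `K`, being closed under links, contains all of
  -- them or none.
  have hface : ∀ x y : ℤ, k (x, y, false) + k (x, y + 1, false) + k (x, y, true) +
      k (x + 1, y, true) = 0 := by
    intro x y
    have hbsum : b (x, y, false) + b (x, y + 1, false) + b (x, y, true) + b (x + 1, y, true) = 0 := by
      simp only [hb, src, tgt, cond_true, cond_false]
      linear_combination h2 (parity S x y) + h2 (parity S (x + 1) y) +
        h2 (parity S x (y + 1)) + h2 (parity S (x + 1) (y + 1))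
    by_cases hex : ∃ e, OnFace x y e ∧ K e
    · obtain ⟨e, he, hKe⟩ := hex
      have hall : ∀ f, OnFace x y f → k f = b f := by
        intro f hf
        by_cases hbf : InBoundary S f
        · have : K f := by
            obtain ⟨h₁, z, hz, hzb, hzr⟩ := hKe
            exact ⟨hbf, z, hz, hzb, hzr.tail ⟨h₁, hbf, x, y, he, hf⟩⟩
          simp [k, b, this, hbf]
        · have : ¬ K f := fun h => hbf h.1
          simp [k, b, this, hbf]
      rw [hall _ (by simp [OnFace]), hall _ (by simp [OnFace]), hall _ (by simp [OnFace]),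
        hall _ (by simp [OnFace]), hbsum]
    · push Not at hex
      have hall : ∀ f, OnFace x y f → k f = 0 := fun f hf => if_neg (hex f hf)
      rw [hall _ (by simp [OnFace]), hall _ (by simp [OnFace]), hall _ (by simp [OnFace]),
        hall _ (by simp [OnFace])]
      simp
  -- the number of these edges in a row is even
  let row : ℤ → ZMod 2 := fun y => ∑ i ∈ Finset.range (M + M), k (-M + i, y, false)
  -- Summing the face relation over the strip between two rows, each interior vertical edge counts
  -- twice and the two extreme ones vanish.
  have hrow : ∀ y, row y = row (y + 1) := by
    intro y
    have hV : ∀ x : ℤ, (M : ℤ) ≤ |x| → k (x, y, true) = 0 := by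
      intro x hx
      apply hk0
      simp [hb, src, tgt, hout _ _ (Or.inl hx)]
    have hs := sum_range_add_succ (fun i => k (-M + i, y, true)) (M + M)
    rw [hV _ (by simp), hV _ (by push_cast; rw [neg_add_cancel_left]; simp)] at hs
    have : row y + row (y + 1) = 0 := by
      rw [← Finset.sum_add_distrib]
      calc _ = ∑ i ∈ Finset.range (M + M),
            (k (-M + i, y, true) + k (-M + (i + 1 : ℕ), y, true)) := by
              refine Finset.sum_congr rfl fun i _ => ?_
              have := hface (-M + i) y
              push_cast
              rw [← add_assoc]
              linear_combination this - h2 (k (-M + i, y, true)) - h2 (k (-M + i + 1, y, true))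
        _ = 0 := by rw [hs]; simp
    linear_combination this - h2 (row (y + 1))
  have hrow0 : row 0 = 0 := by
    have : ∀ n : ℕ, row 0 = row n := by
      intro n
      induction n with
      | zero => simp
      | succ n ih => rw [ih, hrow]; push_cast; rfl
    rw [this M]
    refine Finset.sum_eq_zero fun i _ => hk0 _ ?_
    simp [hb, src, tgt, hout _ (M : ℤ) (Or.inr (by simp))]
  -- the number of these edges on the right half axis is odd
  have hright : ∑ i ∈ Finset.range M, k ((i : ℕ), 0, false) = 1 := by
    have : ∀ i : ℕ, k ((i : ℤ), 0, false) = parity S i 0 + parity S (i + 1 : ℕ) 0 := by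
      intro i
      have hkb : k ((i : ℤ), 0, false) = b ((i : ℤ), 0, false) := by
        by_cases h : InBoundary S ((i : ℤ), 0, false)
        · have : K ((i : ℤ), 0, false) := ⟨h, i, by simp, h, .refl⟩
          simp [k, b, this, h]
        · have : ¬ K ((i : ℤ), 0, false) := fun h' => h h'.1
          simp [k, b, this, h]
      rw [hkb, hb]
      simp [src, tgt]
    simp_rw [this]
    rw [sum_range_add_succ (fun i => parity S i 0), hout M 0 (Or.inl (by simp))]
    simp [parity, h0]
  -- The whole axis carries an even count and its right half an odd one.
  have hleft : ∑ i ∈ Finset.range M, k (-M + (i : ℕ), 0, false) ≠ 0 := by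
    intro h
    have := hrow0
    simp only [row] at this
    rw [Finset.sum_range_add, h] at this
    push_cast at this
    simp only [neg_add_cancel_left, zero_add] at this
    rw [hright] at this
    exact one_ne_zero this
  obtain ⟨i, hi, hki⟩ := Finset.exists_ne_zero_of_sum_ne_zero hleft
  have hKi : K (-M + (i : ℕ), 0, false) := by
    by_contra h
    exact hki (if_neg h)
  obtain ⟨-, x, hx, hxb, hxr⟩ := hKi
  have := Finset.mem_range.1 hi
  exact ⟨x, -M + i, hx, by omega, hxb, hxr⟩

/-! ### Probability of closed escaping sequences -/

theorem adj_src_tgt (e : GridEdge) : squareLattice.Adj e.src e.tgt := by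
  obtain ⟨x, y, s⟩ := e
  cases s <;> simp [squareLattice, src, tgt]

/-- The edge of the square lattice with the given coordinates. -/
def toEdge (e : GridEdge) : squareLattice.edgeSet := ⟨s(e.src, e.tgt), e.adj_src_tgt⟩

/-- All edges of the list are closed. -/
def allClosed (l : List GridEdge) : Set (BondConfig squareLattice) :=
  {ω | ∀ e ∈ l, ω e.toEdge = false}

theorem mem_toEdge {e : GridEdge} {v : ℤ × ℤ} :
    v ∈ (e.toEdge : Sym2 (ℤ × ℤ)) ↔ v = e.src ∨ v = e.tgt := by
  simp [toEdge]

end GridEdge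

open GridEdge

theorem measurableSet_coord_eq {ι : Type*} (i : ι) (b : Bool) :
    MeasurableSet {x : ι → Bool | x i = b} := by
  have h : Measurable fun x : ι → Bool => x i := measurable_pi_apply i
  exact h (measurableSet_singleton b)

theorem real_closed_le {μ : BondModel squareLattice} {p : ℝ}
    (hμ : μ ∈ oneIndependentModels squareLattice p) (e : squareLattice.edgeSet) :
    (μ : Measure (BondConfig squareLattice)).real {ω | ω e = false} ≤ 1 - p := by
  have hmeas : MeasurableSet {ω : BondConfig squareLattice | ω e = true} :=
    measurableSet_coord_eq e true
  have h : {ω : BondConfig squareLattice | ω e = false} = {ω | ω e = true}ᶜ := by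
    ext ω
    simp
  rw [h, probReal_compl_eq_one_sub hmeas]
  have := hμ.2 e
  linarith

/-- The head shares no vertex with any later edge, so 1-independence splits off a factor `1 - p` at
each induction step. -/
theorem real_allClosed_le {μ : BondModel squareLattice} {p : ℝ}
    (hμ : μ ∈ oneIndependentModels squareLattice p) (hp : p ≤ 1) {l : List GridEdge}
    (hl : l.Pairwise fun e f => ¬ Touch e f) :
    (μ : Measure (BondConfig squareLattice)).real (allClosed l) ≤ (1 - p) ^ l.length := by
  induction l with
  | nil => simp
  | cons a l ih =>
    rw [List.pairwise_cons] at hl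
    let S₁ : Set squareLattice.edgeSet := {a.toEdge}
    let S₂ : Set squareLattice.edgeSet := {f | ∃ e ∈ l, e.toEdge = f}
    have hind := hμ.1 S₁ S₂ (by
      rintro _ rfl _ ⟨f, hf, rfl⟩ v hv hv'
      exact hl.1 f hf (touch_of_common_vertex (mem_toEdge.1 hv) (mem_toEdge.1 hv')))
    let A : Set (S₁ → Bool) := {x | x ⟨a.toEdge, rfl⟩ = false}
    let B : Set (S₂ → Bool) := ⋂ f : S₂, {x | x f = false}
    have hA : MeasurableSet A := measurableSet_coord_eq _ false
    have hB : MeasurableSet B := by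
      have : Countable S₂ := by
        have : S₂ = toEdge '' {e | e ∈ l} := rfl
        rw [this]
        exact ((List.finite_toSet l).image _).countable
      exact MeasurableSet.iInter fun f => measurableSet_coord_eq f false
    have hmul := hind.measure_inter_preimage_eq_mul A B hA hB
    have h₁ : (fun (ω : BondConfig squareLattice) (e : S₁) => ω e) ⁻¹' A =
        {ω | ω a.toEdge = false} := rfl
    have h₂ : (fun (ω : BondConfig squareLattice) (f : S₂) => ω f) ⁻¹' B = allClosed l := by
      ext ω
      simp only [B, Set.mem_preimage, Set.mem_iInter, allClosed]
      constructor
      · intro h e he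
        exact h ⟨e.toEdge, e, he, rfl⟩
      · rintro h ⟨_, e, he, rfl⟩
        exact h e he
    have h₃ : allClosed (a :: l) = {ω | ω a.toEdge = false} ∩ allClosed l := by
      ext ω
      simp [allClosed]
    rw [h₁, h₂, ← h₃] at hmul
    rw [Measure.real, hmul, ENNReal.toReal_mul, List.length_cons, pow_succ']
    exact mul_le_mul (real_closed_le hμ _) (ih hl.2) ENNReal.toReal_nonneg (by linarith)

/-- The event that some escaping sequence of length `3 * m + 2` that starts with `e` is closed. -/
def closedEscape (m : ℕ) (e : GridEdge) : Set (BondConfig squareLattice) :=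
  {ω | ∃ l ∈ escapingFrom m e, Escaping l ∧ l.length = 3 * m + 2 ∧ ω ∈ allClosed l}

theorem mem_closedEscape {m : ℕ} {e : GridEdge} {l : List GridEdge} {ω : BondConfig squareLattice}
    (hE : Escaping (e :: l)) (hl : l.length = 3 * m + 1) (hω : ω ∈ allClosed (e :: l)) :
    ω ∈ closedEscape m e :=
  ⟨e :: l, mem_escapingFrom hE hl, hE, by rw [List.length_cons, hl], hω⟩

theorem real_closedEscape_le {μ : BondModel squareLattice} {p : ℝ}
    (hμ : μ ∈ oneIndependentModels squareLattice p) (hp : p ≤ 1) (m : ℕ) (e : GridEdge) :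
    (μ : Measure (BondConfig squareLattice)).real (closedEscape m e) ≤
      10 * 261 ^ m * (1 - p) ^ (3 * m + 2) := by
  classical
  -- `escapingFrom` may also contain non-escaping lists, for which the product bound could fail;
  -- filtering discards them.
  have hsub : closedEscape m e ⊆ ⋃ l ∈ (escapingFrom m e).filter
      fun l => Escaping l ∧ l.length = 3 * m + 2, allClosed l := by
    rintro ω ⟨l, hl, h₁, h₂, h₃⟩
    exact Set.mem_biUnion (Finset.mem_coe.2 (Finset.mem_filter.2 ⟨hl, h₁, h₂⟩)) h₃
  refine (measureReal_mono hsub (measure_ne_top _ _)).trans ?_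
  refine (measureReal_biUnion_finset_le _ _).trans ?_
  have hle : ∀ l ∈ (escapingFrom m e).filter fun l => Escaping l ∧ l.length = 3 * m + 2,
      (μ : Measure (BondConfig squareLattice)).real (allClosed l) ≤ (1 - p) ^ (3 * m + 2) := by
    intro l hl
    obtain ⟨-, h₁, h₂⟩ := Finset.mem_filter.1 hl
    rw [← h₂]
    exact real_allClosed_le hμ hp h₁.pairwise_not_touch
  refine (Finset.sum_le_card_nsmul _ _ _ hle).trans ?_
  rw [nsmul_eq_mul]
  refine mul_le_mul_of_nonneg_right ?_ (pow_nonneg (by linarith) _)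
  exact_mod_cast (Finset.card_filter_le _ _).trans (card_escapingFrom_le m e)

/-! ### Finite clusters force closed escaping sequences -/

theorem forall_mem_of_isChain_cons {α : Type*} {r : α → α → Prop} {P : α → Prop}
    (hP : ∀ a b, r a b → P b) {a : α} {l : List α} (h : (a :: l).IsChain r) : ∀ b ∈ l, P b := by
  induction l generalizing a with
  | nil => simp
  | cons b l ih =>
    rw [List.isChain_cons_cons] at h
    exact List.forall_mem_cons.2 ⟨hP _ _ h.1, ih h.2⟩

/-- A finite set of vertices that contains a long segment of the horizontal axis and whose
boundary edges are all closed yields a closed escaping sequence. -/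
theorem exists_mem_closedEscape_of_boundary {ω : BondConfig squareLattice} {S : Set (ℤ × ℤ)}
    (hS : S.Finite) {N : ℕ} (hN : 12 ≤ N) (hseg : ∀ i : ℕ, i ≤ N → ((i : ℤ), (0 : ℤ)) ∈ S)
    (hclosed : ∀ e, InBoundary S e → ω e.toEdge = false) :
    ∃ R ≥ N, ω ∈ closedEscape (R / 8) ((R : ℤ), 0, false) := by
  obtain ⟨x, x', hx, hx', hxb, hxr⟩ :=
    exists_boundary_chain hS (by simpa using hseg 0 (Nat.zero_le N))
  obtain ⟨R, rfl⟩ := Int.eq_ofNat_of_zero_le hx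
  have hR : N ≤ R := by
    by_contra! h
    have h₁ := hseg R h.le
    have h₂ := hseg (R + 1) h
    push_cast at h₂
    exact hxb (iff_of_true h₁ h₂)
  refine ⟨R, hR, ?_⟩
  obtain ⟨l, hl, hlast⟩ := List.exists_isChain_cons_of_relationReflTransGen hxr
  have hbd : ∀ e ∈ l, InBoundary S e := forall_mem_of_isChain_cons (fun _ _ h => h.2.1) hl
  obtain ⟨t, ht, hE, hN⟩ := exists_escaping_of_isChain l _ (hl.imp fun _ _ h => h.2.2)
  rw [hlast] at hN
  have h₁ := hN.sub_two_le
  have h₂ := hE.le_getLast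
  have h₃ : (R : ℤ) - 2 * t.length ≤ x' + 2 := h₂.trans (by linarith)
  -- Since `x' ≤ -1`, `h₃` gives `t.length ≥ (R - 1) / 2` as a real bound; this is at least `3 * R /
  -- 8 + 1` once `R ≥ 12`, whence the choice `R / 8` and the hypothesis `12 ≤ N`.
  obtain ⟨m, hm⟩ : ∃ m, m = R / 8 := ⟨_, rfl⟩
  have hlen : (t.take (3 * m + 1)).length = 3 * m + 1 := List.length_take_of_le (by omega)
  have hE' : Escaping (((R : ℤ), 0, false) :: t.take (3 * m + 1)) := hE.take (3 * m + 1 + 1)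
  rw [← hm]
  refine mem_closedEscape hE' hlen fun e he => ?_
  rcases List.mem_cons.1 he with rfl | he
  · exact hclosed _ hxb
  · exact hclosed _ (hbd _ (ht (List.mem_of_mem_take he)))

/-- If all open clusters are finite, then there are closed escaping sequences that start
arbitrarily far to the right on the horizontal axis. -/
theorem exists_mem_closedEscape {ω : BondConfig squareLattice}
    (hω : ∀ C : (openSubgraph ω).ConnectedComponent, C.supp.Finite) (N : ℕ) :
    ∃ R ≥ N, ω ∈ closedEscape (R / 8) ((R : ℤ), 0, false) := by
  let S : Set (ℤ × ℤ) := ⋃ i ∈ Set.Iic (N + 12),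
    ((openSubgraph ω).connectedComponentMk ((i : ℤ), 0)).supp
  have hS : S.Finite := (Set.finite_Iic _).biUnion fun i _ => hω _
  have hadj : ∀ u v, (openSubgraph ω).Adj u v → (u ∈ S ↔ v ∈ S) := by
    intro u v huv
    simp only [S, Set.mem_iUnion, SimpleGraph.ConnectedComponent.mem_supp_iff,
      SimpleGraph.ConnectedComponent.sound huv.reachable]
  obtain ⟨R, hR, h⟩ := exists_mem_closedEscape_of_boundary (ω := ω) hS (Nat.le_add_left 12 N)
    (fun i hi => Set.mem_biUnion (Set.mem_Iic.2 hi) rfl) (by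
      intro e he
      by_contra h
      rw [Bool.not_eq_false] at h
      exact he (hadj _ _ ⟨e.adj_src_tgt, h⟩))
  exact ⟨R, (Nat.le_add_right N 12).trans hR, h⟩

/-! ### Borel–Cantelli and the conclusion -/

theorem ae_exists_infinite_cluster {μ : BondModel squareLattice}
    (hμ : μ ∈ oneIndependentModels squareLattice 0.8457) :
    ∀ᵐ ω ∂(μ : Measure (BondConfig squareLattice)),
      ∃ C : (openSubgraph ω).ConnectedComponent, C.supp.Infinite := by
  have hbound : ∀ R : ℕ, (μ : Measure (BondConfig squareLattice))
      (closedEscape (R / 8) ((R : ℤ), 0, false)) ≤ ENNReal.ofReal (0.995 ^ R) := by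
    intro R
    rw [← ofReal_measureReal]
    refine ENNReal.ofReal_le_ofReal ((real_closedEscape_le hμ (by norm_num) _ _).trans ?_)
    have h : R = 8 * (R / 8) + R % 8 := by omega
    generalize R / 8 = m at h
    -- Numerically `261 * 0.1543 ^ 3 ≈ 0.9588`, just below `0.995 ^ 8 ≈ 0.9607`.
    calc (10 : ℝ) * 261 ^ m * (1 - 0.8457) ^ (3 * m + 2)
        = 10 * (1 - 0.8457) ^ 2 * (261 * (1 - 0.8457) ^ 3) ^ m := by
          rw [mul_pow, ← pow_mul, pow_add]; ring
      _ ≤ 0.995 ^ 8 * (0.995 ^ 8) ^ m := by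
          gcongr <;> norm_num
      _ = 0.995 ^ (8 + 8 * m) := by rw [← pow_mul, ← pow_add]
      _ ≤ 0.995 ^ R := pow_le_pow_of_le_one (by norm_num) (by norm_num) (by omega)
  have hsum : ∑' R : ℕ, (μ : Measure (BondConfig squareLattice))
      (closedEscape (R / 8) ((R : ℤ), 0, false)) ≠ ⊤ := by
    refine ne_top_of_le_ne_top ?_ (ENNReal.tsum_le_tsum hbound)
    rw [← ENNReal.ofReal_tsum_of_nonneg (fun n => by positivity)
      (summable_geometric_of_lt_one (by norm_num) (by norm_num))]
    exact ENNReal.ofReal_ne_top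
  filter_upwards [ae_eventually_notMem hsum] with ω hω
  by_contra! h
  obtain ⟨N, hN⟩ := Filter.eventually_atTop.1 hω
  obtain ⟨R, hR, hmem⟩ := exists_mem_closedEscape (fun C => h C) N
  exact hN R hR hmem

theorem percolates_of_mem {μ : BondModel squareLattice}
    (hμ : μ ∈ oneIndependentModels squareLattice 0.8457) : Percolates μ := by
  have h := ae_exists_infinite_cluster hμ
  rw [Percolates, pos_iff_ne_zero]
  intro h0
  rw [measure_eq_zero_iff_ae_notMem] at h0
  obtain ⟨ω, h₁, h₂⟩ := (h.and h0).exists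
  exact h₂ h₁

theorem oneIndependentModels_anti {V : Type*} (G : SimpleGraph V) :
    Antitone (oneIndependentModels G) :=
  fun _ _ h _ hμ => ⟨hμ.1, fun e => h.trans (hμ.2 e)⟩

end Percolation

theorem theorem1p1 :
    (∀ μ ∈ Percolation.oneIndependentModels Percolation.squareLattice 0.8457,
      Percolation.Percolates μ) ∧
    Percolation.pMax Percolation.squareLattice ≤ 0.8457 := by
  -- `Real.sSup_le` also asks for a nonnegative bound, because the real supremum of the empty set is
  -- `0`.
  refine ⟨fun μ hμ => Percolation.percolates_of_mem hμ, Real.sSup_le ?_ (by norm_num)⟩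
  rintro p ⟨μ, hμ, hnot⟩
  by_contra! hp
  exact hnot (Percolation.percolates_of_mem (Percolation.oneIndependentModels_anti _ hp.le hμ))
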